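/- Let $F$ be a field of arbitrary characteristic. An associative, not necessarily unital, $F$-algebra $A$ is called a locally matrix algebra if every finite subset of $A$ is contained in a subalgebra $B\subseteq A$ with $B\cong M_n(F)$ for some $n\ge 1$. Let $\mathrm{Der}(A)$ be the Lie algebra of all $F$-linear derivations of $A$, let $\mathrm{Inder}(A)$ be its ideal of inner derivations $x\mapsto ax-xa$ $(a\in A)$, and let $\mathrm{Outder}(A)=\mathrm{Der}(A)/\mathrm{Inder}(A)$. A Lie algebra is called locally finite-dimensional if each of its finitely generated subalgebras is finite-dimensional. Theorem. Let $A$ be a locally matrix algebra over $F$, unital or not, of countably infinite dimension. Then the Lie algebra $\mathrm{Outder}(A)$ is not locally finite-dimensional. Moreover, there exist derivations $z,y_1,y_2,\dots\in\mathrm{Der}(A)$ such that $[z,y_k]=y_{k+1}$ for all $k\ge 1$ and such that the $y_k$, $k\ge 1$, are linearly independent modulo $\mathrm{Inder}(A)$. -/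

import Mathlib

attribute [local instance 100] LieRing.ofAssociativeRing

/-- An associative, not necessarily unital, `F`-algebra `A` is a locally matrix algebra if every
finite subset of `A` lies in a subalgebra of `A` that is isomorphic, as an `F`-algebra, to the
algebra of `n × n` matrices over `F` for some positive integer `n`. The unit of such a subalgebra
need not be a unit of `A`. -/
def IsLocallyMatrixAlgebra (F A : Type*) [Field F] [NonUnitalRing A] [Module F A]
    [IsScalarTower F A A] [SMulCommClass F A A] : Prop :=
  ∀ S : Finset A, ∃ B : NonUnitalSubalgebra F A, (S : Set A) ⊆ (B : Set A) ∧
    ∃ n : ℕ, 0 < n ∧ ∃ f : Matrix (Fin n) (Fin n) F →ₙₐ[F] B, Function.Bijective f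

/-- The Lie algebra `Der(A)` of all derivations of a not necessarily unital `F`-algebra `A`, as a
Lie subalgebra of the `F`-linear endomorphisms of `A` with the commutator bracket. -/
def derAlgebra (F A : Type*) [Field F] [NonUnitalRing A] [Module F A]
    [IsScalarTower F A A] [SMulCommClass F A A] : LieSubalgebra F (Module.End F A) where
  carrier := {d | ∀ x y : A, d (x * y) = d x * y + x * d y}
  zero_mem' := by intro x y; simp
  add_mem' := by
    intro d e hd he x y
    simp only [LinearMap.add_apply, hd x y, he x y, add_mul, mul_add]
    abel
  smul_mem' := by
    intro c d hd x y
    simp only [LinearMap.smul_apply, hd x y, smul_add, smul_mul_assoc, mul_smul_comm]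
  lie_mem' := by
    intro d e hd he x y
    have hd' : ∀ x y : A, d (x * y) = d x * y + x * d y := hd
    have he' : ∀ x y : A, e (x * y) = e x * y + x * e y := he
    simp only [LieRing.of_associative_ring_bracket, LinearMap.sub_apply, Module.End.mul_apply,
      hd', he', map_add, sub_mul, mul_sub]
    abel

/-- The inner derivation `x ↦ a * x - x * a`. -/
def adDer (F : Type*) {A : Type*} [Field F] [NonUnitalRing A] [Module F A]
    [IsScalarTower F A A] [SMulCommClass F A A] (a : A) : derAlgebra F A :=
  ⟨LinearMap.mulLeft F a - LinearMap.mulRight F a, by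
    intro x y
    simp only [LinearMap.sub_apply, LinearMap.mulLeft_apply, LinearMap.mulRight_apply, sub_mul,
      mul_sub, mul_assoc]
    abel⟩

/-- The ideal `Inder(A)` of all inner derivations in `Der(A)`. -/
def innerDerIdeal (F A : Type*) [Field F] [NonUnitalRing A] [Module F A]
    [IsScalarTower F A A] [SMulCommClass F A A] : LieIdeal F (derAlgebra F A) where
  carrier := {d | ∃ a : A, d = adDer F a}
  zero_mem' := ⟨0, by ext x; simp [adDer]⟩
  add_mem' := by
    rintro _ _ ⟨a, rfl⟩ ⟨b, rfl⟩
    refine ⟨a + b, ?_⟩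
    ext x
    simp [adDer, add_mul, mul_add]
    abel
  smul_mem' := by
    rintro c _ ⟨a, rfl⟩
    refine ⟨c • a, ?_⟩
    ext x
    simp [adDer, smul_sub, smul_mul_assoc, mul_smul_comm]
  lie_mem := by
    rintro d _ ⟨a, rfl⟩
    refine ⟨(d : Module.End F A) a, ?_⟩
    ext x
    have hd : ∀ x y : A, (d : Module.End F A) (x * y)
        = (d : Module.End F A) x * y + x * (d : Module.End F A) y := d.2
    simp only [adDer, LieSubalgebra.coe_bracket, LieRing.of_associative_ring_bracket,
      LinearMap.sub_apply, Module.End.mul_apply, LinearMap.mulLeft_apply,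
      LinearMap.mulRight_apply, map_sub, hd]
    abel

/-- The Lie algebra `Outder(A) = Der(A) / Inder(A)` of outer derivations. -/
abbrev OuterDer (F A : Type*) [Field F] [NonUnitalRing A] [Module F A]
    [IsScalarTower F A A] [SMulCommClass F A A] : Type _ :=
  derAlgebra F A ⧸ innerDerIdeal F A

/-- A Lie algebra is locally finite-dimensional if each of its finitely generated subalgebras is
finite-dimensional. -/
def IsLocallyFiniteDimensionalLie (F L : Type*) [Field F] [LieRing L] [LieAlgebra F L] : Prop :=
  ∀ S : Finset L, FiniteDimensional F (LieSubalgebra.lieSpan F L (S : Set L))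

/-! A sum `∑ i, ad (w i)` is a derivation as soon as each element commutes with almost all `w i`.
Such sums give `z = ∑ ad (z i)` and `y k = ∑ ad (c i k)`, where `ad (z i)` moves `c i k` to `c i (k
+ 1)` and blocks with different `i` commute as needed; hence `[z, y k] = y (k + 1)`. If a
combination of the `y k` equals `ad u`, evaluate it at a test element `p n` with `n` large: `ad u`
kills `p n`, while `y k` sends it to `c n k`, and `c n 0, …, c n (n - 1)` are independent.

The blocks are built inside copies of matrix algebras centralizing a given finite set
(`IsLocallyMatrixAlgebra.exists_nonUnitalAlgHom_commute`). Countable dimension allows each new block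
to centralize the earlier ones and one more member of a spanning sequence. -/

theorem Matrix.rank_add_le_rank_add_rank {F : Type*} [Field F] {N : ℕ}
    (A B : Matrix (Fin N) (Fin N) F) : (A + B).rank ≤ A.rank + B.rank := by
  unfold Matrix.rank
  refine le_trans (Submodule.finrank_mono ?_)
    (Submodule.finrank_add_le_finrank_add_finrank (LinearMap.range A.mulVecLin)
      (LinearMap.range B.mulVecLin))
  rintro _ ⟨v, rfl⟩
  rw [Matrix.mulVecLin_add, LinearMap.add_apply]
  exact Submodule.add_mem_sup ⟨v, rfl⟩ ⟨v, rfl⟩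

theorem Matrix.rank_sum_le_sum_rank {F : Type*} [Field F] {N : ℕ} {ι : Type*} (s : Finset ι)
    (A : ι → Matrix (Fin N) (Fin N) F) : (∑ i ∈ s, A i).rank ≤ ∑ i ∈ s, (A i).rank := by
  classical
  induction s using Finset.induction_on with
  | empty => simp
  | insert i s hi ih =>
    rw [Finset.sum_insert hi, Finset.sum_insert hi]
    exact (Matrix.rank_add_le_rank_add_rank _ _).trans (by gcongr)

/-! ### Matrix algebras in corners and centralizers -/

/-- An idempotent matrix `f` of rank at least `n` dominates an idempotent `P * Q` that is split
through `F ^ n`. -/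
theorem Matrix.exists_splitting_of_idempotent {F : Type*} [Field F] {N n : ℕ}
    {f : Matrix (Fin N) (Fin N) F} (hf : f * f = f) (hn : n ≤ f.rank) :
    ∃ (P : Matrix (Fin N) (Fin n) F) (Q : Matrix (Fin n) (Fin N) F),
      Q * P = 1 ∧ f * P = P ∧ Q * f = Q := by
  obtain ⟨v, hv⟩ := exists_linearIndependent_of_le_finrank hn
  have hv' : LinearIndependent F fun i => (v i : Fin N → F) :=
    hv.map' (LinearMap.range f.mulVecLin).subtype (Submodule.ker_subtype _)
  let P : Matrix (Fin N) (Fin n) F := Matrix.of fun i j => (v j : Fin N → F) i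
  have hfP : f * P = P := by
    ext i j
    obtain ⟨w, hw⟩ := (v j).2
    have h : f.mulVec (v j : Fin N → F) = (v j : Fin N → F) := by
      rw [← hw, Matrix.mulVecLin_apply, Matrix.mulVec_mulVec, hf]
    exact congrFun h i
  have hinj : Function.Injective P.mulVec := Matrix.mulVec_injective_iff.2 hv'
  obtain ⟨g, hg⟩ := P.mulVecLin.exists_leftInverse_of_injective (LinearMap.ker_eq_bot.2 hinj)
  have hgP : LinearMap.toMatrix' g * P = 1 := by
    have h := congrArg LinearMap.toMatrix' hg
    rwa [LinearMap.toMatrix'_comp, LinearMap.toMatrix'_id, ← Matrix.toLin'_apply',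
      LinearMap.toMatrix'_toLin'] at h
  -- A left inverse of `P` need not absorb `f` on the right; multiplying it by `f` repairs this and
  -- keeps `Q * P = 1`, since `f * P = P`.
  exact ⟨P, LinearMap.toMatrix' g * f, by rw [Matrix.mul_assoc, hfP, hgP], hfP,
    by rw [Matrix.mul_assoc, hf]⟩

/-- The corner of an idempotent of rank at least `n` contains a copy of the `n × n` matrices. -/
theorem Matrix.exists_nonUnitalAlgHom_corner {F : Type*} [Field F] {N n : ℕ}
    {f : Matrix (Fin N) (Fin N) F} (hf : f * f = f) (hn : n ≤ f.rank) :
    ∃ ψ : Matrix (Fin n) (Fin n) F →ₙₐ[F] Matrix (Fin N) (Fin N) F,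
      Function.Injective ψ ∧ ∀ X, f * ψ X = ψ X ∧ ψ X * f = ψ X := by
  obtain ⟨P, Q, hQP, hP, hQ⟩ := Matrix.exists_splitting_of_idempotent hf hn
  refine ⟨{ toFun := fun X => P * X * Q
            map_smul' := fun c X => by simp
            map_zero' := by simp
            map_add' := fun X Y => by simp [Matrix.mul_add, Matrix.add_mul]
            map_mul' := fun X Y => by
              simp only [Matrix.mul_assoc]
              rw [← Matrix.mul_assoc Q P, hQP, Matrix.one_mul] }, ?_, fun X => ⟨?_, ?_⟩⟩
  · intro X Y h
    have h' : P * X * Q = P * Y * Q := h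
    have key : ∀ Z : Matrix (Fin n) (Fin n) F, Q * (P * Z * Q) * P = Z := fun Z => by
      simp only [Matrix.mul_assoc, hQP, Matrix.mul_one]
      rw [← Matrix.mul_assoc, hQP, Matrix.one_mul]
    rw [← key X, h', key Y]
  · change f * (P * X * Q) = P * X * Q
    rw [← Matrix.mul_assoc, ← Matrix.mul_assoc, hP]
  · change P * X * Q * f = P * X * Q
    rw [Matrix.mul_assoc, hQ]

/-- A system of `m × m` matrix units inside the `N × N` matrices with `(m + 1) * n ≤ N` is
centralized by a copy of the `n × n` matrices. -/
theorem Matrix.exists_nonUnitalAlgHom_commute_matrixUnits {F : Type*} [Field F] {N m n : ℕ}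
    (hm : 0 < m) (E : Fin m → Fin m → Matrix (Fin N) (Fin N) F)
    (hE : ∀ a b c d, E a b * E c d = if b = c then E a d else 0) (hN : (m + 1) * n ≤ N) :
    ∃ ψ : Matrix (Fin n) (Fin n) F →ₙₐ[F] Matrix (Fin N) (Fin N) F,
      Function.Injective ψ ∧ ∀ X a b, Commute (ψ X) (E a b) := by
  let o : Fin m := ⟨0, hm⟩
  let e := ∑ a, E a a
  have heE : ∀ a b, e * E a b = E a b := fun a b => by simp [e, Finset.sum_mul, hE]
  have hEe : ∀ a b, E a b * e = E a b := fun a b => by simp [e, Finset.mul_sum, hE]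
  have hee : e * e = e := by
    conv_lhs => enter [2]; unfold e
    rw [Finset.mul_sum]
    simp only [heE, e]
  -- As `e` may differ from `1`, there are two sources of room: the corner of `1 - e`, which
  -- annihilates all `E a b`, or, if that is too small, the corner of `E o o`, whose rank is then at
  -- least `n` by counting.
  by_cases h : n ≤ (1 - e).rank
  · obtain ⟨ψ, hψ, hc⟩ := Matrix.exists_nonUnitalAlgHom_corner
      (show (1 - e) * (1 - e) = 1 - e by simp [mul_sub, sub_mul, hee]) h
    refine ⟨ψ, hψ, fun X a b => ?_⟩
    have h1 : ψ X * E a b = 0 := by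
      rw [← (hc X).2, mul_assoc, sub_mul, heE, one_mul, sub_self, mul_zero]
    have h2 : E a b * ψ X = 0 := by
      rw [← (hc X).1, ← mul_assoc, mul_sub, hEe, mul_one, sub_self, zero_mul]
    exact h1.trans h2.symm
  · have hrank : ∀ a, (E a a).rank ≤ (E o o).rank := fun a => by
      have : E a a = E a o * (E o o * E o a) := by simp [hE]
      rw [this]
      exact (Matrix.rank_mul_le_right _ _).trans (Matrix.rank_mul_le_left _ _)
    have hN' : N ≤ m * (E o o).rank + (1 - e).rank := by
      calc N = (e + (1 - e)).rank := by simp [Matrix.rank_one]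
        _ ≤ e.rank + (1 - e).rank := Matrix.rank_add_le_rank_add_rank _ _
        _ ≤ _ := by
          gcongr
          refine (Matrix.rank_sum_le_sum_rank _ _).trans
            ((Finset.sum_le_sum fun a _ => hrank a).trans ?_)
          simp
    have hn : n ≤ (E o o).rank := by
      by_contra hlt
      have : m * (E o o).rank ≤ m * n := by gcongr; omega
      have : (m + 1) * n = m * n + n := by ring
      omega
    obtain ⟨ψ, hψ, hc⟩ := Matrix.exists_nonUnitalAlgHom_corner
      (show E o o * E o o = E o o by simp [hE]) hn
    have hL : ∀ X a b, E a b * ∑ c, E c o * ψ X * E o c = E a o * ψ X * E o b := fun X a b => by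
      rw [Finset.mul_sum, Finset.sum_eq_single b]
      · simp only [← mul_assoc, hE, if_true]
      · intro c _ hcb
        simp only [← mul_assoc, hE, if_neg hcb.symm, zero_mul]
      · simp
    have hR : ∀ X a b, (∑ c, E c o * ψ X * E o c) * E a b = E a o * ψ X * E o b := fun X a b => by
      rw [Finset.sum_mul, Finset.sum_eq_single a]
      · simp only [mul_assoc, hE, if_true]
      · intro c _ hca
        simp only [mul_assoc, hE, if_neg hca, mul_zero]
      · simp
    -- Diagonal embedding: the corner of `E o o` is copied into every diagonal block.
    refine ⟨{ toFun := fun X => ∑ c, E c o * ψ X * E o c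
              map_smul' := fun r X => by simp [Finset.smul_sum]
              map_zero' := by simp
              map_add' := fun X Y => by simp [mul_add, add_mul, Finset.sum_add_distrib]
              map_mul' := fun X Y => ?_ }, ?_, fun X a b => ?_⟩
    · rw [Finset.sum_mul]
      refine Finset.sum_congr rfl fun c _ => ?_
      rw [mul_assoc (E c o * ψ X), hL, map_mul]
      simp only [← mul_assoc]
      rw [mul_assoc _ (ψ X) (E o o), (hc X).2]
    · intro X Y hXY
      have key : ∀ Z, E o o * (∑ c, E c o * ψ Z * E o c) = ψ Z := fun Z => by
        rw [hL, (hc Z).1, (hc Z).2]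
      exact hψ (by rw [← key X, ← key Y]; exact congrArg (E o o * ·) hXY)
    · exact (hR X a b).trans (hL X a b).symm

/-! ### Commuting blocks in locally matrix algebras -/

/-- In a locally matrix algebra of infinite dimension, every finite set is centralized by copies
of matrix algebras of every size. -/
theorem IsLocallyMatrixAlgebra.exists_nonUnitalAlgHom_commute {F A : Type*} [Field F]
    [NonUnitalRing A] [Module F A] [IsScalarTower F A A] [SMulCommClass F A A]
    (hA : IsLocallyMatrixAlgebra F A) (hdim : Cardinal.aleph0 ≤ Module.rank F A)
    (S : Finset A) (n : ℕ) :
    ∃ ψ : Matrix (Fin n) (Fin n) F →ₙₐ[F] A,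
      Function.Injective ψ ∧ ∀ X, ∀ s ∈ S, Commute (ψ X) s := by
  classical
  obtain ⟨B, hSB, m, hm, f, hf⟩ := hA S
  let e : Fin m → Fin m → A := fun a b => f (Matrix.single a b 1)
  -- This many independent elements force `N ^ 2 ≥ ((m + 1) * n) ^ 2` for the larger matrix algebra.
  obtain ⟨T, hTcard, hT⟩ := exists_finset_linearIndependent_of_le_rank (R := F) (M := A)
    (n := ((m + 1) * n) ^ 2) (Cardinal.natCast_le_aleph0.trans hdim)
  obtain ⟨C, hC, N, hN, g, hg⟩ := hA (T ∪ Finset.univ.image fun p : Fin m × Fin m => e p.1 p.2)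
  have hTC : ∀ t ∈ T, t ∈ C := fun t ht => hC (by simp [ht])
  have heC : ∀ a b, e a b ∈ C := fun a b => hC (by simp)
  have hle : (m + 1) * n ≤ N := by
    let γ : Matrix (Fin N) (Fin N) F →ₗ[F] A :=
      { toFun := fun X => g X
        map_add' := fun X Y => by simp
        map_smul' := fun r X => by simp }
    have hspan : Submodule.span F (T : Set A) ≤ LinearMap.range γ := by
      rw [Submodule.span_le]
      intro t ht
      obtain ⟨X, hX⟩ := hg.2 ⟨t, hTC t ht⟩
      exact ⟨X, congrArg Subtype.val hX⟩
    have h := (Submodule.finrank_mono hspan).trans γ.finrank_range_le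
    rw [finrank_span_finset_eq_card hT, hTcard, Module.finrank_matrix] at h
    simp only [Fintype.card_fin, Module.finrank_self, mul_one, ← sq] at h
    exact (Nat.pow_le_pow_iff_left two_ne_zero).1 h
  choose E hE' using fun a b => hg.2 ⟨e a b, heC a b⟩
  have hE : ∀ a b c d, E a b * E c d = if b = c then E a d else 0 := fun a b c d => by
    apply hg.1
    apply Subtype.ext
    have h1 : e a b * e c d = if b = c then e a d else 0 := by
      simp only [e]
      rw [← NonUnitalSubalgebra.coe_mul, ← map_mul]
      split_ifs with h
      · subst h; simp
      · simp [Matrix.single_mul_single_of_ne, h]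
    rw [map_mul, NonUnitalSubalgebra.coe_mul, hE', hE', h1]
    split_ifs
    · rw [hE']
    · simp
  obtain ⟨ψ, hψ, hc⟩ := Matrix.exists_nonUnitalAlgHom_commute_matrixUnits hm E hE hle
  let ι := NonUnitalSubalgebraClass.subtype C
  refine ⟨ι.comp (g.comp ψ), Subtype.val_injective.comp (hg.1.comp hψ), fun X s hs => ?_⟩
  obtain ⟨M, hM⟩ := hf.2 ⟨s, hSB hs⟩
  have hM' : s = ∑ a, ∑ b, M a b • e a b := by
    have : s = f M := by rw [hM]
    rw [this]
    conv_lhs => rw [Matrix.matrix_eq_sum_single M]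
    simp only [map_sum, AddSubmonoidClass.coe_finsetSum, e]
    refine Finset.sum_congr rfl fun a _ => Finset.sum_congr rfl fun b _ => ?_
    rw [← NonUnitalSubalgebra.coe_smul, ← map_smul, Matrix.smul_single, smul_eq_mul, mul_one]
  rw [hM']
  refine Commute.sum_right _ _ _ fun a _ => Commute.sum_right _ _ _ fun b _ =>
    Commute.smul_right ?_ _
  have h := congrArg (fun Y => (g Y : A)) (hc X a b).eq
  simp only [map_mul, NonUnitalSubalgebra.coe_mul, hE'] at h
  exact h

/-- Over an infinite-dimensional locally matrix algebra, every finite set is centralized by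
elements `z`, `p` and a sequence `c`, obtained by iterating `ad z`, on which `p` acts as a right
unit and left annihilator and whose first `n` terms are linearly independent. -/
theorem IsLocallyMatrixAlgebra.exists_ad_chain {F A : Type*} [Field F]
    [NonUnitalRing A] [Module F A] [IsScalarTower F A A] [SMulCommClass F A A]
    (hA : IsLocallyMatrixAlgebra F A) (hdim : Cardinal.aleph0 ≤ Module.rank F A)
    (S : Finset A) (n : ℕ) :
    ∃ (z p : A) (c : ℕ → A), (∀ s ∈ S, Commute z s ∧ Commute p s ∧ Commute (c 0) s) ∧
      (∀ k, z * c k - c k * z = c (k + 1)) ∧ (∀ k, c k * p = c k ∧ p * c k = 0) ∧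
      LinearIndependent F fun k : Fin n => c k := by
  obtain ⟨ψ, hψ, hc⟩ := hA.exists_nonUnitalAlgHom_commute hdim S (n + 1)
  -- `J` is the subdiagonal shift and `c k` is the matrix unit at `(k + 1, 0)`, zero once `k ≥ n`.
  -- Row `0` is left free so that `c k * J = 0` and the unit at `(0, 0)` kills `c k` from the left.
  let J : Matrix (Fin (n + 1)) (Fin (n + 1)) F :=
    Matrix.of fun i j => if (i : ℕ) = j + 1 then 1 else 0
  let c : ℕ → Matrix (Fin (n + 1)) (Fin (n + 1)) F :=
    fun k => Matrix.of fun i j => if (i : ℕ) = k + 1 ∧ j = 0 then 1 else 0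
  have hcJ : ∀ k, c k * J = 0 := fun k => by
    ext i j
    rw [Matrix.mul_apply]
    refine Finset.sum_eq_zero fun l _ => ?_
    by_cases hl : l = 0 <;> simp [c, J, hl]
  have hJc : ∀ k, J * c k = c (k + 1) := fun k => by
    ext i j
    rw [Matrix.mul_apply]
    simp only [c, J, Matrix.of_apply, ite_mul, one_mul, zero_mul]
    by_cases hi : (i : ℕ) = k + 1 + 1
    · have hk : k + 1 < n + 1 := by have := i.2; omega
      rw [Finset.sum_eq_single ⟨k + 1, hk⟩]
      · simp [hi]
      · intro l _ hl
        rw [if_neg]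
        intro h
        exact hl (Fin.ext (by simp only; omega))
      · simp
    · rw [Finset.sum_eq_zero]
      · simp [hi]
      · intro l _
        split_ifs <;> first | rfl | omega
  have hcp : ∀ k, c k * Matrix.single 0 0 1 = c k := fun k => by
    ext i j
    by_cases hj : j = 0
    · subst hj; simp
    · rw [Matrix.mul_single_apply_of_ne (hbj := hj)]
      simp [c, hj]
  have hpc : ∀ k, Matrix.single 0 0 1 * c k = 0 := fun k => by
    ext i j
    by_cases hi : i = 0
    · subst hi; simp [c]
    · rw [Matrix.single_mul_apply_of_ne (h := hi)]
      simp
  have hli : LinearIndependent F fun k : Fin n => c k := by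
    rw [Fintype.linearIndependent_iff]
    intro a ha k
    have h := congrFun (congrFun ha k.succ) 0
    rw [Matrix.sum_apply, Finset.sum_eq_single k] at h
    · simpa [c] using h
    · intro l _ hl
      have : (k : ℕ) ≠ l := fun h => hl (Fin.ext h.symm)
      simp [c, this]
    · simp
  refine ⟨ψ J, ψ (Matrix.single 0 0 1), fun k => ψ (c k),
    fun s hs => ⟨hc _ s hs, hc _ s hs, hc _ s hs⟩, fun k => ?_,
    fun k => ⟨?_, ?_⟩, ?_⟩
  · change ψ J * ψ (c k) - ψ (c k) * ψ J = ψ (c (k + 1))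
    rw [← map_mul ψ J, ← map_mul ψ (c k), hcJ, hJc, map_zero, sub_zero]
  · rw [← map_mul, hcp]
  · rw [← map_mul, hpc, map_zero]
  · exact hli.map' (ψ : Matrix (Fin (n + 1)) (Fin (n + 1)) F →ₗ[F] A)
      (LinearMap.ker_eq_bot.2 hψ)

/-- An infinite-dimensional locally matrix algebra of countable dimension contains a sequence of
pairwise commuting `ad`-chains of growing length such that every element commutes with almost all
of them. -/
theorem IsLocallyMatrixAlgebra.exists_ad_chain_sequence {F A : Type*} [Field F]
    [NonUnitalRing A] [Module F A] [IsScalarTower F A A] [SMulCommClass F A A]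
    (hA : IsLocallyMatrixAlgebra F A) (hdim : Module.rank F A = Cardinal.aleph0) :
    ∃ (z p : ℕ → A) (c : ℕ → ℕ → A),
      (∀ x, ∃ N, ∀ i ≥ N, Commute (z i) x ∧ Commute (p i) x ∧ ∀ k, Commute (c i k) x) ∧
      (∀ i j, i ≠ j → ∀ k, Commute (z i) (c j k) ∧ Commute (c i k) (p j)) ∧
      (∀ i k, z i * c i k - c i k * z i = c i (k + 1)) ∧
      (∀ i k, c i k * p i = c i k ∧ p i * c i k = 0) ∧
      ∀ n, LinearIndependent F fun k : Fin n => c n k := by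
  classical
  obtain ⟨b, hb⟩ : ∃ b : ℕ → A, Submodule.span F (Set.range b) = ⊤ := by
    let B := Module.Basis.ofVectorSpace F A
    have hB : Cardinal.mk (Module.Basis.ofVectorSpaceIndex F A) = Cardinal.aleph0 := by
      rw [B.mk_eq_rank'', hdim]
    obtain ⟨hden⟩ := Cardinal.denumerable_iff.2 hB
    exact ⟨_, (B.reindex (Denumerable.eqv _)).span_eq⟩
  choose z p c hcomm hzc hcp hli using hA.exists_ad_chain hdim.ge
  -- `S n` holds the first `n` spanning vectors and the generators of the first `n` blocks; block
  -- `n` is chosen to centralize it.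
  let S : ℕ → Finset A := fun n => Nat.rec ∅
    (fun n S => S ∪ {b n, z S n, p S n, c S n 0}) n
  have hS : ∀ n, S (n + 1) = S n ∪ {b n, z (S n) n, p (S n) n, c (S n) n 0} := fun n => rfl
  have hmono : Monotone S := monotone_nat_of_le_succ fun n => by
    rw [hS]; exact Finset.subset_union_left
  -- Since `c (k + 1)` is a commutator of `z` and `c k`, only `c 0` has to be recorded in `S`.
  have hck : ∀ i x, Commute (z (S i) i) x → Commute (c (S i) i 0) x →
      ∀ k, Commute (c (S i) i k) x := fun i x hz h0 k => by
    induction k with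
    | zero => exact h0
    | succ k ih =>
      rw [← hzc]
      exact (hz.mul_left ih).sub_left (ih.mul_left hz)
  have hlt : ∀ i j, j < i → ∀ x ∈ ({b j, z (S j) j, p (S j) j, c (S j) j 0} : Finset A),
      Commute (z (S i) i) x ∧ Commute (p (S i) i) x ∧ ∀ k, Commute (c (S i) i k) x := by
    intro i j hji x hx
    have hxi : x ∈ S i := hmono (Nat.succ_le_of_lt hji)
      (by rw [hS]; exact Finset.mem_union_right _ hx)
    obtain ⟨h1, h2, h3⟩ := hcomm _ i x hxi
    exact ⟨h1, h2, hck i x h1 h3⟩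
  refine ⟨fun i => z (S i) i, fun i => p (S i) i, fun i => c (S i) i, fun x => ?_,
    fun i j hij k => ?_, fun i k => hzc _ _ _, fun i k => hcp _ _ _, fun n => hli _ _⟩
  · have hx : x ∈ Submodule.span F (Set.range b) := hb ▸ Submodule.mem_top
    induction hx using Submodule.span_induction with
    | mem x hx =>
      obtain ⟨j, rfl⟩ := hx
      exact ⟨j + 1, fun i hi => hlt i j hi _ (by simp)⟩
    | zero => exact ⟨0, fun i _ => ⟨Commute.zero_right _, Commute.zero_right _,
        fun k => Commute.zero_right _⟩⟩
    | add x y _ _ hx hy =>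
      obtain ⟨N, hN⟩ := hx
      obtain ⟨M, hM⟩ := hy
      refine ⟨max N M, fun i hi => ?_⟩
      obtain ⟨h1, h2, h3⟩ := hN i (le_of_max_le_left hi)
      obtain ⟨h1', h2', h3'⟩ := hM i (le_of_max_le_right hi)
      exact ⟨h1.add_right h1', h2.add_right h2', fun k => (h3 k).add_right (h3' k)⟩
    | smul r x _ hx =>
      obtain ⟨N, hN⟩ := hx
      refine ⟨N, fun i hi => ?_⟩
      obtain ⟨h1, h2, h3⟩ := hN i hi
      exact ⟨h1.smul_right r, h2.smul_right r, fun k => (h3 k).smul_right r⟩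
  · rcases lt_or_gt_of_ne hij with h | h
    · obtain ⟨_, hp, -⟩ := hlt j i h (c (S i) i 0) (by simp)
      obtain ⟨_, hp', hc'⟩ := hlt j i h (z (S i) i) (by simp)
      exact ⟨(hc' k).symm, hck i _ hp'.symm hp.symm k⟩
    · obtain ⟨hz, -, -⟩ := hlt i j h (c (S j) j 0) (by simp)
      obtain ⟨hz', -, -⟩ := hlt i j h (z (S j) j) (by simp)
      exact ⟨(hck j _ hz'.symm hz.symm k).symm, (hlt i j h (p (S j) j) (by simp)).2.2 k⟩

/-! ### Infinite sums of inner derivations -/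

/-- The sum `∑ i, ad (w i)` of inner derivations, for a sequence `w` such that each element
commutes with almost all `w i`. -/
noncomputable def sumAdDer (F : Type*) {A : Type*} [Field F] [NonUnitalRing A] [Module F A]
    [IsScalarTower F A A] [SMulCommClass F A A] (w : ℕ → A)
    (hw : ∀ x, ∃ N, ∀ i ≥ N, Commute (w i) x) : derAlgebra F A :=
  have hfin : ∀ x, (fun i => w i * x - x * w i).HasFiniteSupport := fun x => by
    obtain ⟨N, hN⟩ := hw x
    refine (Set.finite_lt_nat N).subset fun i hi => ?_
    by_contra h
    exact hi (sub_eq_zero.2 (hN i (not_lt.1 h)).eq)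
  ⟨{ toFun := fun x => ∑ᶠ i, (w i * x - x * w i)
     map_add' := fun x y => by
      rw [← finsum_add_distrib (hfin x) (hfin y)]
      refine finsum_congr fun i => ?_
      rw [mul_add, add_mul]
      abel
     map_smul' := fun r x => by
      rw [RingHom.id_apply, smul_finsum' r (hfin x)]
      refine finsum_congr fun i => ?_
      rw [mul_smul_comm, smul_mul_assoc, smul_sub] }, fun x y => by
    change ∑ᶠ i, (w i * (x * y) - x * y * w i) =
      (∑ᶠ i, (w i * x - x * w i)) * y + x * ∑ᶠ i, (w i * y - y * w i)
    rw [finsum_mul' _ _ (hfin x), mul_finsum' _ _ (hfin y), ← finsum_add_distrib]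
    · refine finsum_congr fun i => ?_
      simp only [sub_mul, mul_sub, mul_assoc]
      abel
    · exact (hfin x).subset fun i hi h => hi ((congrArg (· * y) h).trans (zero_mul y))
    · exact (hfin y).subset fun i hi h => hi ((congrArg (x * ·) h).trans (mul_zero x))⟩

theorem sumAdDer_apply (F : Type*) {A : Type*} [Field F] [NonUnitalRing A] [Module F A]
    [IsScalarTower F A A] [SMulCommClass F A A] (w : ℕ → A)
    (hw : ∀ x, ∃ N, ∀ i ≥ N, Commute (w i) x) (x : A) :
    (sumAdDer F w hw : Module.End F A) x = ∑ᶠ i, (w i * x - x * w i) := rfl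

/-- On an element that commutes with all `w i` except `w j`, the sum acts as `ad (w j)`. -/
theorem sumAdDer_apply_eq_single (F : Type*) {A : Type*} [Field F] [NonUnitalRing A] [Module F A]
    [IsScalarTower F A A] [SMulCommClass F A A] (w : ℕ → A)
    (hw : ∀ x, ∃ N, ∀ i ≥ N, Commute (w i) x) {x : A} {j : ℕ}
    (hx : ∀ i, i ≠ j → Commute (w i) x) :
    (sumAdDer F w hw : Module.End F A) x = w j * x - x * w j :=
  finsum_eq_single _ j fun i hi => sub_eq_zero.2 (hx i hi).eq

/-- The bracket of a derivation with a sum of inner derivations is computed termwise. -/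
theorem lie_sumAdDer (F : Type*) {A : Type*} [Field F] [NonUnitalRing A] [Module F A]
    [IsScalarTower F A A] [SMulCommClass F A A] (d : derAlgebra F A) (w w' : ℕ → A)
    (hw : ∀ x, ∃ N, ∀ i ≥ N, Commute (w i) x) (hw' : ∀ x, ∃ N, ∀ i ≥ N, Commute (w' i) x)
    (hd : ∀ i, (d : Module.End F A) (w i) = w' i) :
    ⁅d, sumAdDer F w hw⁆ = sumAdDer F w' hw' := by
  ext x
  have hder : ∀ x y : A, (d : Module.End F A) (x * y)
      = (d : Module.End F A) x * y + x * (d : Module.End F A) y := d.2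
  obtain ⟨N₁, hN₁⟩ := hw x
  obtain ⟨N₂, hN₂⟩ := hw ((d : Module.End F A) x)
  obtain ⟨N₃, hN₃⟩ := hw' x
  -- One bound serves all three sums, so they can be compared term by term.
  have key : ∀ (v : ℕ → A) (y : A) (n : ℕ), (∀ i ≥ n, Commute (v i) y) →
      n ≤ max N₁ (max N₂ N₃) →
      ∑ᶠ i, (v i * y - y * v i) =
        ∑ i ∈ Finset.range (max N₁ (max N₂ N₃)), (v i * y - y * v i) := by
    intro v y n hn hle
    refine finsum_eq_sum_of_support_subset _ fun i hi => ?_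
    simp only [Finset.coe_range, Set.mem_Iio]
    by_contra h
    exact hi (sub_eq_zero.2 (hn i (hle.trans (not_lt.1 h))).eq)
  simp only [LieSubalgebra.coe_bracket, LieRing.of_associative_ring_bracket,
    LinearMap.sub_apply, Module.End.mul_apply, sumAdDer_apply]
  rw [key w x N₁ hN₁ (by simp), key w _ N₂ hN₂ (by simp), key w' x N₃ hN₃ (by simp),
    map_sum, ← Finset.sum_sub_distrib]
  refine Finset.sum_congr rfl fun i _ => ?_
  rw [map_sub, hder, hder, hd]
  abel

/-- A Lie algebra with an infinite linearly independent family obtained by iterating `ad z` is not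
locally finite-dimensional. -/
theorem not_isLocallyFiniteDimensionalLie_of_chain {F L : Type*} [Field F] [LieRing L]
    [LieAlgebra F L] (z : L) (y : ℕ → L) (hzy : ∀ k, ⁅z, y k⁆ = y (k + 1))
    (hli : LinearIndependent F y) : ¬ IsLocallyFiniteDimensionalLie F L := by
  classical
  intro h
  have := h {z, y 0}
  set K := LieSubalgebra.lieSpan F L (({z, y 0} : Finset L) : Set L)
  have hz : z ∈ K := LieSubalgebra.subset_lieSpan (by simp)
  have hy : ∀ k, y k ∈ K := fun k => by
    induction k with
    | zero => exact LieSubalgebra.subset_lieSpan (by simp)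
    | succ k ih => rw [← hzy]; exact K.lie_mem hz ih
  have hli' : LinearIndependent F fun k => (⟨y k, hy k⟩ : K) :=
    LinearIndependent.of_comp K.toSubmodule.subtype hli
  exact not_finite_iff_infinite.2 inferInstance hli'.finite_of_isNoetherian

theorem theorem3 {F A : Type*} [Field F] [NonUnitalRing A] [Module F A]
    [IsScalarTower F A A] [SMulCommClass F A A]
    (hA : IsLocallyMatrixAlgebra F A) (hdim : Module.rank F A = Cardinal.aleph0) :
    ¬ IsLocallyFiniteDimensionalLie F (OuterDer F A) ∧
    ∃ (z : derAlgebra F A) (y : ℕ → derAlgebra F A),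
      (∀ k : ℕ, ⁅z, y k⁆ = y (k + 1)) ∧
      LinearIndependent F
        (fun k : ℕ => LieSubmodule.Quotient.mk' (innerDerIdeal F A) (y k)) := by
  suffices h : ∃ (z : derAlgebra F A) (y : ℕ → derAlgebra F A),
      (∀ k : ℕ, ⁅z, y k⁆ = y (k + 1)) ∧
      LinearIndependent F
        (fun k : ℕ => LieSubmodule.Quotient.mk' (innerDerIdeal F A) (y k)) by
    refine ⟨?_, h⟩
    obtain ⟨z, y, hzy, hli⟩ := h
    refine not_isLocallyFiniteDimensionalLie_of_chain
      (LieSubmodule.Quotient.mk' (innerDerIdeal F A) z) _ (fun k => ?_) hli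
    rw [← hzy k]
    exact (LieSubmodule.Quotient.mk_bracket (innerDerIdeal F A) z (y k)).symm
  obtain ⟨z, p, c, hfin, hcomm, hzc, hcp, hli⟩ := hA.exists_ad_chain_sequence hdim
  have hz : ∀ x, ∃ N, ∀ i ≥ N, Commute (z i) x := fun x =>
    (hfin x).imp fun N h i hi => (h i hi).1
  have hc : ∀ k x, ∃ N, ∀ i ≥ N, Commute (c i k) x := fun k x =>
    (hfin x).imp fun N h i hi => (h i hi).2.2 k
  refine ⟨sumAdDer F z hz, fun k => sumAdDer F (fun i => c i k) (hc k), fun k => ?_, ?_⟩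
  · refine lie_sumAdDer F _ _ _ _ _ fun i => ?_
    rw [sumAdDer_apply_eq_single F z hz fun j hj => (hcomm j i hj k).1, hzc]
  · rw [linearIndependent_iff']
    intro s a hs
    have hmem : ∑ k ∈ s, a k • sumAdDer F (fun i => c i k) (hc k) ∈ innerDerIdeal F A := by
      rw [← LieSubmodule.Quotient.mk_eq_zero, map_sum]
      simpa only [map_smul] using hs
    obtain ⟨u, hu⟩ := hmem
    obtain ⟨N, hN⟩ := hfin u
    obtain ⟨M, hM⟩ := s.exists_nat_subset_range
    -- `N` makes `p n` commute with `u`; `M` puts all indices in `s` below `n`, the range where the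
    -- `c n k` are independent.
    let n := max N M
    have h := congrArg (fun d : derAlgebra F A => (d : Module.End F A) (p n)) hu
    have hterm : ∀ k, (sumAdDer F (fun i => c i k) (hc k) : Module.End F A) (p n) = c n k := by
      intro k
      rw [sumAdDer_apply_eq_single F _ (hc k) fun i hi => (hcomm i n hi k).2, (hcp n k).1,
        (hcp n k).2, sub_zero]
    have hsum : ∑ k ∈ s, a k • c n k = 0 := by
      have hr : (adDer F u : Module.End F A) (p n) = 0 :=
        sub_eq_zero.2 (hN n (le_max_left _ _)).2.1.symm.eq
      rw [← hr, ← h]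
      rw [AddSubmonoidClass.coe_finsetSum, LinearMap.sum_apply]
      exact Finset.sum_congr rfl fun k _ => congrArg (a k • ·) (hterm k).symm
    have hs' : ∀ k ∈ s, k < n := fun k hk =>
      (Finset.mem_range.1 (hM hk)).trans_le (le_max_right _ _)
    have hli' : LinearIndepOn F (c n) (Set.Iio n) :=
      (linearIndependent_equiv' Fin.equivSubtype rfl).1 (hli n)
    exact linearIndepOn_iff'.1 hli' s a (fun k hk => hs' k hk) hsum
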